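/- A poset $P$ is *ranked* if it has a strictly increasing rank function $\rho:P\to\mathbb{Z}_{\ge 0}$ that is $0$ on minimal elements and satisfies $\rho(y)=\rho(x)+1$ whenever $y$ covers $x$. A ranked poset is *upho* if every rank $P_k=\rho^{-1}(k)$ is finite and for every $s\in P$ the principal order filter $V_s=\{t\in P: t\ge s\}$ is isomorphic to $P$; its rank-generating function is $F_P(x)=\sum_{k\ge 0}|P_k|x^k$. It has up-degree $b$ if every element is covered by exactly $b$ elements. A *planar Hasse diagram* of $P$ places the elements of $P$ at distinct points of the plane, those of rank $i$ at height $y=i$, and draws each cover relation as a straight segment, in such a way that two different edges never meet except at a common endpoint; $P$ is *planar* if it has such a diagram. Given a planar Hasse diagram, a vertex $v$ is *root-bifurcated* if it covers exactly two vertices $v_1,v_2$, the meet of $v_1$ and $v_2$ is the least element $\hat 0$ of $P$, and no vertex of the same rank lies strictly between $v_1$ and $v_2$ in the diagram. **Theorem 1.3.** (1) Let $P$ be an infinite planar upho poset, with any fixed planar Hasse diagram. Then $P$ has an up-degree $b\in\mathbb{Z}_{\ge 0}$. If $a_i$ denotes the number of root-bifurcated vertices of rank $i$, then there is an $n$ with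 $a_i=0$ for all $i\notin\{2,\dots,n\}$, and with $$Q(x)=1-bx+a_2x^2+a_3x^3+\cdots+a_nx^n$$ we have $F_P(x)=Q(x)^{-1}$ in $\mathbb{Z}[[x]]$ and $Q(1)\le 0$. (2) Conversely, let $b,n,a_2,\dots,a_n\in\mathbb{Z}_{\ge 0}$ and let $Q(x)=1-bx+a_2x^2+\cdots+a_nx^n$ satisfy $Q(1)\le 0$. Then there is an infinite planar upho poset $P$ with up-degree $b$ and $F_P(x)=Q(x)^{-1}$. -/

import Mathlib

open Polynomial

/-- A ranked poset (its rank function is `grade ℕ`: strictly increasing, raised by exactly one along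
each cover relation, zero at minimal elements) is *upho* if every rank is finite and every principal
order filter is isomorphic to the whole poset. -/
def IsUpho (P : Type*) [PartialOrder P] [GradeMinOrder ℕ P] : Prop :=
  (∀ k : ℕ, {v : P | grade ℕ v = k}.Finite) ∧ ∀ s : P, Nonempty (Set.Ici s ≃o P)

/-- Every vertex is covered by exactly `b` vertices. -/
def HasUpDegree (P : Type*) [PartialOrder P] (b : ℕ) : Prop :=
  ∀ v : P, {w : P | v ⋖ w}.encard = b

/-- The rank-generating function `∑ₖ |Pₖ| xᵏ`. -/
noncomputable def rankGenFun (P : Type*) [PartialOrder P] [GradeMinOrder ℕ P] : PowerSeries ℤ :=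
  PowerSeries.mk fun k => ({v : P | grade ℕ v = k}.ncard : ℤ)

/-- A planar Hasse diagram: a vertex `v` of rank `i` is drawn at the point `(xpos v, i)`, distinct
vertices at distinct points, a cover relation is drawn as the line segment between its two ends, and
two different edges never meet except at a common end. (The ends of an edge lie on two consecutive
horizontal lines, so it suffices to ask that edges without their ends are disjoint.) -/
structure PlanarDiagram (P : Type*) [PartialOrder P] [GradeMinOrder ℕ P] where
  /-- the horizontal coordinate of a vertex -/
  xpos : P → ℝ
  point_injective : Function.Injective fun v : P => (xpos v, (grade ℕ v : ℝ))
  edges_disjoint : ∀ u v u' v' : P, u ⋖ v → u' ⋖ v' → (u, v) ≠ (u', v') →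
    Disjoint
      (openSegment ℝ (xpos u, (grade ℕ u : ℝ)) (xpos v, (grade ℕ v : ℝ)))
      (openSegment ℝ (xpos u', (grade ℕ u' : ℝ)) (xpos v', (grade ℕ v' : ℝ)))

/-- Two distinct vertices of the same rank are adjacent in the diagram if no vertex of that rank
lies strictly between them. -/
def PlanarDiagram.Adjacent {P : Type*} [PartialOrder P] [GradeMinOrder ℕ P] (D : PlanarDiagram P)
    (u v : P) : Prop :=
  u ≠ v ∧ grade ℕ u = grade ℕ v ∧
    ∀ w : P, grade ℕ w = grade ℕ u →
      ¬ (D.xpos u < D.xpos w ∧ D.xpos w < D.xpos v) ∧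
      ¬ (D.xpos v < D.xpos w ∧ D.xpos w < D.xpos u)

/-- `v` covers exactly two vertices, their meet is the least element of the poset, and they are
adjacent in the diagram. -/
def PlanarDiagram.RootBifurcated {P : Type*} [PartialOrder P] [GradeMinOrder ℕ P]
    (D : PlanarDiagram P) (v : P) : Prop :=
  ∃ v₁ v₂ : P, v₁ ≠ v₂ ∧ {w : P | w ⋖ v} = {v₁, v₂} ∧
    (∃ z : P, IsBot z ∧ IsGLB {v₁, v₂} z) ∧ D.Adjacent v₁ v₂

/-- The number of root-bifurcated vertices of rank `i`. -/
noncomputable def PlanarDiagram.rootBifurcatedCount {P : Type*} [PartialOrder P]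
    [GradeMinOrder ℕ P] (D : PlanarDiagram P) (i : ℕ) : ℕ :=
  {v : P | grade ℕ v = i ∧ D.RootBifurcated v}.ncard

/-- The polynomial `Q(x) = 1 - b x + a₂ x² + ⋯ + aₙ xⁿ`. -/
noncomputable def denomPoly (b n : ℕ) (a : ℕ → ℕ) : ℤ[X] :=
  1 - C (b : ℤ) * X + ∑ i ∈ Finset.Icc 2 n, C (a i : ℤ) * X ^ i

/-!
If `u` and `u'` lie in one rank and rising paths from them arrive in the opposite horizontal order,
then planarity makes the paths share a vertex. Consequently two vertices of equal rank have a meet,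
no vertex covers more than two others, and a vertex `v` covering `v₁` and `v₂` is bifurcated at
exactly one point, the meet `c` of `v₁` and `v₂`. By the isomorphism of the filter of `c` with `P`
the vertices of rank `k` bifurcated at points of rank `j` number `a_{k-j} |P_j|`, so counting the
cover relations below rank `k + 1` gives `|P_{k+1}| + ∑ a_i |P_{k+1-i}| = b |P_k|`, which is
`Q F = 1`. A root-bifurcated vertex is the join of two neighbouring atoms, and `b` atoms have only
`b - 1` neighbouring pairs, whence `Q(1) ≤ 0`.

Conversely, draw the poset row by row, every vertex having `b` children that are consecutive in the
next row. It is then determined by the sequence of gaps between neighbouring vertices, a gap saying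
how many rows later the two families of descendants first meet. Giving the `b - 1` gaps between
siblings the value `i - 1` for `a_i` of them makes the gap sequence, and hence the poset,
self-similar, and counting the gaps equal to `1` in a row gives the recurrence of `Q⁻¹`.
-/

section Levels

variable {x x' y y' k : ℝ}

theorem openSegment_between_levels (x y k : ℝ) :
    openSegment ℝ (x, k) (y, k + 1) =
      (fun θ : ℝ => ((1 - θ) * x + θ * y, k + θ)) '' Set.Ioo 0 1 := by
  rw [openSegment_eq_image]
  refine Set.image_congr fun θ _ => ?_
  ext
  · simp
  · simp only [Prod.smul_mk, smul_eq_mul, Prod.mk_add_mk]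
    ring

theorem disjoint_openSegment_iff_of_lt (hx : x < x') :
    Disjoint (openSegment ℝ (x, k) (y, k + 1)) (openSegment ℝ (x', k) (y', k + 1)) ↔ y ≤ y' := by
  simp only [openSegment_between_levels, Set.disjoint_left, Set.forall_mem_image]
  constructor
  · intro hdisj
    by_contra! hy
    have hx₀ : 0 < x' - x := sub_pos.2 hx
    have hy₀ : 0 < y - y' := sub_pos.2 hy
    -- The height at which the two lines cross, by similar triangles.
    let θ := (x' - x) / ((x' - x) + (y - y'))
    have hθ : θ ∈ Set.Ioo (0 : ℝ) 1 :=
      ⟨by positivity, (div_lt_one (by positivity)).2 (lt_add_of_pos_right _ hy₀)⟩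
    have hmeet : (1 - θ) * x' + θ * y' = (1 - θ) * x + θ * y := by
      linear_combination -div_mul_cancel₀ (x' - x) (add_pos hx₀ hy₀).ne'
    exact hdisj hθ ⟨θ, hθ, Prod.ext hmeet rfl⟩
  · rintro hy θ ⟨hθ₀, hθ₁⟩ ⟨η, -, heq⟩
    obtain ⟨hfst, hsnd⟩ := Prod.mk.inj heq
    obtain rfl : η = θ := add_left_cancel hsnd
    have := mul_lt_mul_of_pos_left hx (sub_pos.2 hθ₁)
    have := mul_le_mul_of_nonneg_left hy hθ₀.le
    linarith

theorem disjoint_openSegment_of_common_left (hy : y ≠ y') :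
    Disjoint (openSegment ℝ (x, k) (y, k + 1)) (openSegment ℝ (x, k) (y', k + 1)) := by
  simp only [openSegment_between_levels, Set.disjoint_left, Set.forall_mem_image]
  rintro θ ⟨hθ₀, -⟩ ⟨η, -, heq⟩
  obtain ⟨hfst, hsnd⟩ := Prod.mk.inj heq
  obtain rfl : η = θ := add_left_cancel hsnd
  exact hy (mul_left_cancel₀ hθ₀.ne' (add_left_cancel hfst)).symm

theorem disjoint_openSegment_of_level_ne {m n : ℕ} (h : m ≠ n) :
    Disjoint (openSegment ℝ (x, (m : ℝ)) (y, m + 1)) (openSegment ℝ (x', (n : ℝ)) (y', n + 1)) := by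
  simp only [openSegment_between_levels, Set.disjoint_left, Set.forall_mem_image]
  rintro θ ⟨hθ₀, hθ₁⟩ ⟨η, ⟨hη₀, hη₁⟩, heq⟩
  have hheight : (n : ℝ) + η = m + θ := congrArg Prod.snd heq
  have hmn : (m : ℝ) < n + 1 := by linarith
  have hnm : (n : ℝ) < m + 1 := by linarith
  norm_cast at hmn hnm
  omega

end Levels

section Graded

variable {P : Type*} [PartialOrder P]

section GradeOrder

variable [GradeOrder ℕ P] {u v t : P} {r : ℕ}

theorem grade_eq_add_one_of_covBy (h : u ⋖ t) : grade ℕ t = grade ℕ u + 1 :=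
  (Nat.covBy_iff_add_one_eq.1 (h.grade ℕ)).symm

theorem grade_eq_of_covBy_of_covBy (hu : u ⋖ t) (hv : v ⋖ t) : grade ℕ u = grade ℕ v :=
  add_right_cancel ((grade_eq_add_one_of_covBy hu).symm.trans (grade_eq_add_one_of_covBy hv))

theorem eq_of_le_of_grade_le (h : u ≤ t) (hg : grade ℕ t ≤ grade ℕ u) : u = t :=
  h.eq_or_lt.resolve_right fun hlt => (grade_strictMono hlt).not_ge hg

theorem covBy_of_le_of_grade_eq_add_one (h : u ≤ t) (hg : grade ℕ t = grade ℕ u + 1) : u ⋖ t :=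
  covBy_iff_lt_covBy_grade (𝕆 := ℕ).2
    ⟨h.lt_of_ne (by rintro rfl; omega), Nat.covBy_iff_add_one_eq.2 hg.symm⟩

theorem exists_grade_eq_of_le (hut : u ≤ t) (hur : grade ℕ u ≤ r) (hrt : r ≤ grade ℕ t) :
    ∃ m, u ≤ m ∧ m ≤ t ∧ grade ℕ m = r := by
  induction r, hur using Nat.le_induction with
  | base => exact ⟨u, le_rfl, hut, rfl⟩
  | succ r _ ih =>
    obtain ⟨m, hum, hmt, rfl⟩ := ih (by omega)
    obtain ⟨w, hmw, hwt⟩ := exists_covBy_le_of_lt (hmt.lt_of_ne (by rintro rfl; omega))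
    exact ⟨w, hum.trans hmw.le, hwt, grade_eq_add_one_of_covBy hmw⟩

theorem exists_forall_grade_le {s : Set P} (hs : BddAbove s) (hne : s.Nonempty) :
    ∃ c ∈ s, ∀ d ∈ s, grade ℕ d ≤ grade ℕ c := by
  obtain ⟨m, hm⟩ := hs
  have hfin : (grade ℕ '' s).Finite :=
    (Set.finite_Iic (grade ℕ m)).subset <|
      Set.image_subset_iff.2 fun d hd => grade_mono (𝕆 := ℕ) (hm hd)
  obtain ⟨c, hc, hmax⟩ := hfin.exists_maximalFor' (grade ℕ) s hne
  exact ⟨c, hc, fun d hd => (le_total _ _).elim id (hmax hd)⟩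

theorem exists_ge_grade_eq [NoMaxOrder P] (h : grade ℕ u ≤ r) : ∃ t, u ≤ t ∧ grade ℕ t = r := by
  induction r, h using Nat.le_induction with
  | base => exact ⟨u, le_rfl, rfl⟩
  | succ r _ ih =>
    obtain ⟨t, hut, rfl⟩ := ih
    obtain ⟨w, htw⟩ := exists_covBy_of_wellFoundedLT (not_isMax t)
    exact ⟨w, hut.trans htw.le, grade_eq_add_one_of_covBy htw⟩

end GradeOrder

variable [OrderBot P] [GradeMinOrder ℕ P] {v : P}

theorem grade_eq_zero_iff : grade ℕ v = 0 ↔ v = ⊥ :=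
  ⟨fun h => (eq_of_le_of_grade_le bot_le (h.trans_le (Nat.zero_le _))).symm,
    fun h => h ▸ grade_bot⟩

theorem isAtom_iff_grade_eq_one : IsAtom v ↔ grade ℕ v = 1 := by
  have hbot : grade ℕ (⊥ : P) = 0 := grade_bot
  rw [← bot_covBy_iff]
  exact ⟨fun h => by rw [grade_eq_add_one_of_covBy h, hbot],
    fun h => covBy_of_le_of_grade_eq_add_one bot_le (by rw [h, hbot])⟩

theorem exists_covBy_of_ne_bot (hv : v ≠ ⊥) : ∃ u, u ⋖ v := by
  have hpos : grade ℕ v ≠ 0 := mt grade_eq_zero_iff.1 hv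
  have hbot : grade ℕ (⊥ : P) = 0 := grade_bot
  obtain ⟨u, -, huv, hu⟩ := exists_grade_eq_of_le (u := ⊥) (t := v) (r := grade ℕ v - 1) bot_le
    (by omega) (by omega)
  exact ⟨u, covBy_of_le_of_grade_eq_add_one huv (by omega)⟩

theorem HasUpDegree.grade_injective_of_one (hb : HasUpDegree P 1) :
    Function.Injective (grade ℕ : P → ℕ) := by
  intro u v huv
  induction hk : grade ℕ u generalizing u v with
  | zero => rw [grade_eq_zero_iff.1 hk, grade_eq_zero_iff.1 (huv.symm.trans hk)]
  | succ k ih =>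
    have hne : ∀ w : P, grade ℕ w = k + 1 → w ≠ ⊥ := fun w hw =>
      mt grade_eq_zero_iff.2 (by omega)
    obtain ⟨u', hu'⟩ := exists_covBy_of_ne_bot (hne u hk)
    obtain ⟨v', hv'⟩ := exists_covBy_of_ne_bot (hne v (huv ▸ hk))
    have hgu := grade_eq_add_one_of_covBy hu'
    have hgv := grade_eq_add_one_of_covBy hv'
    obtain rfl : u' = v' := ih (by omega) (by omega)
    exact Set.encard_le_one_iff.1 (hb u').le u v hu' hv'

end Graded

namespace PlanarDiagram

section Drawing

variable {P : Type*} [PartialOrder P] [GradeMinOrder ℕ P]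

/-- The planar diagram in which covers of vertices of one rank are drawn in the horizontal order of
those vertices; by `xpos_le_of_covBy` every planar diagram is of this form. -/
def ofMonotone (x : P → ℝ) (hinj : ∀ ⦃u v⦄, grade ℕ u = grade ℕ v → x u = x v → u = v)
    (hmono : ∀ ⦃u v u' v'⦄, grade ℕ u = grade ℕ u' → x u < x u' → u ⋖ v → u' ⋖ v' → x v ≤ x v') :
    PlanarDiagram P where
  xpos := x
  point_injective _ _ h := hinj (Nat.cast_injective (congrArg Prod.snd h)) (congrArg Prod.fst h)
  edges_disjoint u v u' v' h h' hne := by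
    rw [grade_eq_add_one_of_covBy h, grade_eq_add_one_of_covBy h', Nat.cast_succ, Nat.cast_succ]
    by_cases hg : grade ℕ u = grade ℕ u'
    swap
    · exact disjoint_openSegment_of_level_ne hg
    have hgv : grade ℕ v = grade ℕ v' := by
      rw [grade_eq_add_one_of_covBy h, grade_eq_add_one_of_covBy h', hg]
    rw [← hg]
    rcases lt_trichotomy (x u) (x u') with hx | hx | hx
    · exact (disjoint_openSegment_iff_of_lt hx).2 (hmono hg hx h h')
    · obtain rfl := hinj hg hx
      exact disjoint_openSegment_of_common_left fun hxv => hne (by rw [hinj hgv hxv])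
    · exact ((disjoint_openSegment_iff_of_lt hx).2 (hmono hg.symm hx h' h)).symm

variable (D : PlanarDiagram P) {u u' v v' : P}

theorem eq_of_xpos_eq (hg : grade ℕ u = grade ℕ v) (hx : D.xpos u = D.xpos v) : u = v :=
  D.point_injective (by simp only [hg, hx])

theorem xpos_le_of_covBy (hg : grade ℕ u = grade ℕ u') (hx : D.xpos u < D.xpos u')
    (h : u ⋖ v) (h' : u' ⋖ v') : D.xpos v ≤ D.xpos v' := by
  have hdisj := D.edges_disjoint u v u' v' h h' fun he => hx.ne (by rw [(Prod.mk.inj he).1])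
  rw [grade_eq_add_one_of_covBy h, grade_eq_add_one_of_covBy h', hg, Nat.cast_succ] at hdisj
  exact (disjoint_openSegment_iff_of_lt hx).1 hdisj

/-- The reflection of a planar diagram in a vertical line. -/
def mirror : PlanarDiagram P :=
  ofMonotone (fun v => -D.xpos v) (fun _ _ hg hx => D.eq_of_xpos_eq hg (neg_injective hx))
    fun _ _ _ _ hg hx h h' => neg_le_neg (D.xpos_le_of_covBy hg.symm (neg_lt_neg_iff.1 hx) h' h)

variable {t t' m w v₁ v₂ c p : P}

theorem exists_common_of_crossing (hg : grade ℕ u = grade ℕ u') (hg' : grade ℕ t = grade ℕ t')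
    (hut : u ≤ t) (hut' : u' ≤ t') (hx : D.xpos u ≤ D.xpos u') (hx' : D.xpos t' ≤ D.xpos t) :
    ∃ w, u ≤ w ∧ u' ≤ w ∧ w ≤ t ∧ w ≤ t' := by
  induction hk : grade ℕ t - grade ℕ u generalizing u u' with
  | zero =>
    obtain rfl := eq_of_le_of_grade_le hut (by omega)
    obtain rfl := eq_of_le_of_grade_le hut' (by omega)
    obtain rfl := D.eq_of_xpos_eq hg (hx.antisymm hx')
    exact ⟨u, le_rfl, le_rfl, le_rfl, le_rfl⟩
  | succ k ih =>
    rcases hx.eq_or_lt with hx | hx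
    · obtain rfl := D.eq_of_xpos_eq hg hx
      exact ⟨u, le_rfl, le_rfl, hut, hut'⟩
    obtain ⟨w, hw, hwt⟩ := exists_covBy_le_of_lt (hut.lt_of_ne (by rintro rfl; omega))
    obtain ⟨w', hw', hwt'⟩ := exists_covBy_le_of_lt (hut'.lt_of_ne (by rintro rfl; omega))
    have hgw := grade_eq_add_one_of_covBy hw
    have hgw' := grade_eq_add_one_of_covBy hw'
    obtain ⟨s, hws, hws', hst, hst'⟩ :=
      ih (by omega) hwt hwt' (D.xpos_le_of_covBy hg hx hw hw') (by omega)
    exact ⟨s, hw.le.trans hws, hw'.le.trans hws', hst, hst'⟩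

theorem le_of_crossing (hg : grade ℕ u = grade ℕ u') (hg' : grade ℕ t = grade ℕ t')
    (hut : u ≤ t) (hut' : u' ≤ t') (hx : D.xpos u ≤ D.xpos u') (hx' : D.xpos t' ≤ D.xpos t) :
    u ≤ t' ∧ u' ≤ t := by
  obtain ⟨w, huw, huw', hwt, hwt'⟩ := D.exists_common_of_crossing hg hg' hut hut' hx hx'
  exact ⟨huw.trans hwt', huw'.trans hwt⟩

theorem le_of_xpos_between [NoMaxOrder P] (hg : grade ℕ u = grade ℕ m)
    (hg' : grade ℕ m = grade ℕ u') (hx : D.xpos u ≤ D.xpos m) (hx' : D.xpos m ≤ D.xpos u')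
    (hu : u ≤ w) (hu' : u' ≤ w) : m ≤ w := by
  obtain ⟨t, hmt, ht⟩ := exists_ge_grade_eq (u := m) (hg ▸ grade_mono hu)
  rcases le_total (D.xpos t) (D.xpos w) with h | h
  · exact (D.le_of_crossing hg ht.symm hu hmt hx h).2
  · exact (D.le_of_crossing hg' ht hmt hu' hx' h).1

theorem xpos_le_of_maximal_lowerBound (hg : grade ℕ v₁ = grade ℕ v₂)
    (hx : D.xpos v₁ ≤ D.xpos v₂) (hc : Maximal (fun d => d ≤ v₁ ∧ d ≤ v₂) c) (hp : p ≤ v₁)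
    (hpc : grade ℕ p = grade ℕ c) : D.xpos p ≤ D.xpos c := by
  by_contra! hlt
  obtain ⟨w, hcw, hpw, hw₂, hw₁⟩ :=
    D.exists_common_of_crossing hpc.symm hg.symm hc.prop.2 hp hlt.le hx
  obtain rfl : c = w := hc.eq_of_le ⟨hw₁, hw₂⟩ hcw
  exact hlt.ne' (by rw [eq_of_le_of_grade_le hpw hpc.ge])

theorem exists_isGLB [OrderBot P] (D : PlanarDiagram P) (hg : grade ℕ v₁ = grade ℕ v₂) :
    ∃ c, IsGLB {v₁, v₂} c := by
  wlog hx : D.xpos v₁ ≤ D.xpos v₂ generalizing v₁ v₂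
  · rw [Set.pair_comm]
    exact this hg.symm (le_of_not_ge hx)
  obtain ⟨c, hc, hgc⟩ := exists_forall_grade_le (s := {d | d ≤ v₁ ∧ d ≤ v₂})
    ⟨v₁, fun d hd => hd.1⟩ ⟨⊥, bot_le, bot_le⟩
  have hc' : Maximal (fun d => d ≤ v₁ ∧ d ≤ v₂) c :=
    ⟨hc, fun d hd hcd => (eq_of_le_of_grade_le hcd (hgc d hd)).ge⟩
  have hc'' : Maximal (fun d => d ≤ v₂ ∧ d ≤ v₁) c := by simpa only [and_comm] using hc'
  refine ⟨c, by simp [lowerBounds, hc.1, hc.2], fun d hd => ?_⟩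
  have hd₁ : d ≤ v₁ := hd (Set.mem_insert v₁ _)
  have hd₂ : d ≤ v₂ := hd (Set.mem_insert_of_mem _ rfl)
  have hdc := hgc d ⟨hd₁, hd₂⟩
  obtain ⟨p₁, hdp₁, hp₁, hgp₁⟩ := exists_grade_eq_of_le hd₁ hdc (grade_mono hc.1)
  obtain ⟨p₂, hdp₂, hp₂, hgp₂⟩ := exists_grade_eq_of_le hd₂ hdc (grade_mono hc.2)
  have hpc₁ : D.xpos p₁ ≤ D.xpos c := D.xpos_le_of_maximal_lowerBound hg hx hc' hp₁ hgp₁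
  have hpc₂ : D.xpos c ≤ D.xpos p₂ := neg_le_neg_iff.1 <|
    D.mirror.xpos_le_of_maximal_lowerBound hg.symm (neg_le_neg hx) hc'' hp₂ hgp₂
  -- The paths from `d` to `p₁` and `p₂` enclose `c`, so a path from `⊥` to `c` meets one of them.
  obtain ⟨q, -, hqc, hgq⟩ := exists_grade_eq_of_le (bot_le (a := c)) (grade_mono bot_le) hdc
  rcases le_total (D.xpos q) (D.xpos d) with h | h
  · exact (D.le_of_crossing hgq hgp₁.symm hqc hdp₁ h hpc₁).2
  · exact (D.le_of_crossing hgq.symm hgp₂ hdp₂ hqc h hpc₂).1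

end Drawing

end PlanarDiagram

section PrincipalFilter

variable {P Q : Type*} [PartialOrder P] [PartialOrder Q] {f : P ↪o Q} {c : Q}

theorem isGLB_image_iff_of_range_eq_Ici (hf : Set.range f = Set.Ici c) {s : Set P} {x : P}
    (hs : ∃ m, IsGLB (f '' s) m) : IsGLB (f '' s) (f x) ↔ IsGLB s x := by
  refine ⟨IsGLB.of_image f.le_iff_le, fun hx => ?_⟩
  obtain ⟨m, hm⟩ := hs
  have hc : c ∈ lowerBounds (f '' s) :=
    (Set.forall_mem_image).2 fun y _ => hf.subset (Set.mem_range_self y)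
  obtain ⟨y, rfl⟩ := hf.superset (hm.2 hc)
  rwa [hx.unique (hm.of_image f.le_iff_le)]

theorem map_covBy_iff_of_range_eq_Ici (hf : Set.range f = Set.Ici c) {x y : P} :
    f x ⋖ f y ↔ x ⋖ y :=
  Set.OrdConnected.apply_covBy_apply_iff f (hf ▸ Set.ordConnected_Ici)

variable [OrderBot P]

theorem map_bot_of_range_eq_Ici (hf : Set.range f = Set.Ici c) : f ⊥ = c := by
  obtain ⟨y, rfl⟩ := hf.superset Set.self_mem_Ici
  exact le_antisymm (f.monotone bot_le) (hf.subset (Set.mem_range_self ⊥))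

theorem grade_map_of_range_eq_Ici [GradeMinOrder ℕ P] [GradeMinOrder ℕ Q]
    (hf : Set.range f = Set.Ici c) (x : P) : grade ℕ (f x) = grade ℕ c + grade ℕ x := by
  induction hk : grade ℕ x generalizing x with
  | zero => rw [grade_eq_zero_iff.1 hk, map_bot_of_range_eq_Ici hf, add_zero]
  | succ k ih =>
    obtain ⟨u, hu⟩ := exists_covBy_of_ne_bot (mt grade_eq_zero_iff.2 (hk.trans_ne k.succ_ne_zero))
    have hgu := grade_eq_add_one_of_covBy hu
    rw [grade_eq_add_one_of_covBy ((map_covBy_iff_of_range_eq_Ici hf).2 hu), ih u (by omega),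
      add_assoc]

end PrincipalFilter

namespace IsUpho

variable {P : Type*} [PartialOrder P] [GradeMinOrder ℕ P]

theorem exists_orderEmbedding (h : IsUpho P) (s : P) : ∃ f : P ↪o P, Set.range f = Set.Ici s := by
  obtain ⟨e⟩ := h.2 s
  refine ⟨e.symm.toOrderEmbedding.trans (OrderEmbedding.subtype _), Set.ext fun w => ?_⟩
  exact ⟨by rintro ⟨y, rfl⟩; exact (e.symm y).2, fun hw => ⟨e ⟨w, hw⟩, by simp⟩⟩

theorem exists_isBot [Nonempty P] (h : IsUpho P) : ∃ z : P, IsBot z := by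
  obtain ⟨v⟩ := ‹Nonempty P›
  obtain ⟨f, hf⟩ := h.exists_orderEmbedding v
  obtain ⟨z, rfl⟩ := hf.superset Set.self_mem_Ici
  exact ⟨z, fun w => f.le_iff_le.1 (hf.subset (Set.mem_range_self w))⟩

theorem noMaxOrder [Infinite P] (h : IsUpho P) : NoMaxOrder P := by
  refine ⟨fun v => not_isMax_iff.1 fun hv => ?_⟩
  obtain ⟨f, hf⟩ := h.exists_orderEmbedding v
  have hfv : ∀ w, f w = v := fun w => (hv.eq_of_le (hf.subset (Set.mem_range_self w))).symm
  obtain ⟨x, y, hxy⟩ := exists_pair_ne P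
  exact hxy (f.injective ((hfv x).trans (hfv y).symm))

theorem hasUpDegree [OrderBot P] (h : IsUpho P) : HasUpDegree P {w : P | ⊥ ⋖ w}.ncard := by
  intro v
  obtain ⟨f, hf⟩ := h.exists_orderEmbedding v
  have hcov : ∀ {w}, v ⋖ f w ↔ ⊥ ⋖ w := by
    rw [← map_bot_of_range_eq_Ici hf]
    exact map_covBy_iff_of_range_eq_Ici hf
  have himage : {w : P | v ⋖ w} = f '' {w | ⊥ ⋖ w} := by
    refine Set.Subset.antisymm (fun w hw => ?_) (Set.image_subset_iff.2 fun w hw => hcov.2 hw)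
    obtain ⟨y, rfl⟩ := hf.superset hw.le
    exact ⟨y, hcov.1 hw, rfl⟩
  have hfin : {w : P | ⊥ ⋖ w}.Finite :=
    (h.1 1).subset fun w hw => isAtom_iff_grade_eq_one.1 (bot_covBy_iff.1 hw)
  rw [himage, f.injective.encard_image, hfin.cast_ncard_eq]

end IsUpho

/-- `v` covers two distinct elements whose meet is `c`. In a planar upho poset the elements covered
by `v` are then automatically two, and adjacent, so that a root-bifurcated vertex is one that is
bifurcated at `⊥` (`PlanarDiagram.rootBifurcated_iff`). -/
def BifurcatedAt {P : Type*} [PartialOrder P] (c v : P) : Prop :=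
  ∃ v₁ v₂ : P, v₁ ≠ v₂ ∧ v₁ ⋖ v ∧ v₂ ⋖ v ∧ IsGLB {v₁, v₂} c

theorem BifurcatedAt.le {P : Type*} [PartialOrder P] {c v : P} (h : BifurcatedAt c v) :
    c ≤ v := by
  obtain ⟨v₁, v₂, -, h₁, -, hglb⟩ := h
  exact (hglb.1 (Set.mem_insert v₁ _)).trans h₁.le

namespace PlanarDiagram

variable {P : Type*} [PartialOrder P] [GradeMinOrder ℕ P] (D : PlanarDiagram P)

/-- `v` is the next vertex to the right of `u` in its rank. -/
def RightNeighbor (u v : P) : Prop :=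
  D.xpos u < D.xpos v ∧ D.Adjacent u v

variable {D} {u v w : P}

theorem RightNeighbor.xpos_le_or_le (h : D.RightNeighbor u v) (hw : grade ℕ w = grade ℕ u) :
    D.xpos w ≤ D.xpos u ∨ D.xpos v ≤ D.xpos w := by
  by_contra! hlt
  exact (h.2.2.2 w hw).1 hlt

theorem RightNeighbor.right_unique (h : D.RightNeighbor u v) (h' : D.RightNeighbor u w) :
    v = w := by
  have hgv : grade ℕ u = grade ℕ v := h.2.2.1
  have hgw : grade ℕ u = grade ℕ w := h'.2.2.1
  refine D.eq_of_xpos_eq (hgv.symm.trans hgw) (le_antisymm ?_ ?_)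
  · exact (h.xpos_le_or_le hgw.symm).resolve_left h'.1.not_ge
  · exact (h'.xpos_le_or_le hgv.symm).resolve_left h.1.not_ge

theorem rightNeighbor_of_forall (hg : grade ℕ u = grade ℕ v) (hx : D.xpos u < D.xpos v)
    (hbtw : ∀ w, grade ℕ w = grade ℕ u → D.xpos u < D.xpos w → D.xpos v ≤ D.xpos w) :
    D.RightNeighbor u v :=
  ⟨hx, ne_of_apply_ne D.xpos hx.ne, hg, fun w hw =>
    ⟨fun h => (hbtw w hw h.1).not_gt h.2, fun h => (h.1.trans h.2).not_gt hx⟩⟩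

theorem RightNeighbor.mirror (h : D.RightNeighbor u v) : D.mirror.RightNeighbor v u :=
  rightNeighbor_of_forall h.2.2.1.symm (neg_lt_neg h.1) fun _ hw hx =>
    neg_le_neg ((h.xpos_le_or_le (hw.trans h.2.2.1.symm)).resolve_right
      (neg_lt_neg_iff.1 hx).not_ge)

theorem Adjacent.rightNeighbor_or (h : D.Adjacent u v) :
    D.RightNeighbor u v ∨ D.RightNeighbor v u := by
  have hsymm : D.Adjacent v u :=
    ⟨h.1.symm, h.2.1.symm, fun w hw => (h.2.2 w (hw.trans h.2.1.symm)).symm⟩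
  rcases lt_trichotomy (D.xpos u) (D.xpos v) with hx | hx | hx
  · exact .inl ⟨hx, h⟩
  · exact absurd (D.eq_of_xpos_eq h.2.1 hx) h.1
  · exact .inr ⟨hx, hsymm⟩

section UpDegree

variable [OrderBot P] [NoMaxOrder P] {b : ℕ} {m v₁ v₂ c c' : P}

theorem not_covBy_of_xpos_between (D : PlanarDiagram P) (hb : HasUpDegree P b) (hu : u ⋖ v)
    (hg : grade ℕ u = grade ℕ m) (hum : D.xpos u < D.xpos m) (hmw : D.xpos m < D.xpos w) :
    ¬ w ⋖ v := by
  intro hw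
  have hgu := grade_eq_add_one_of_covBy hu
  have hgw := grade_eq_add_one_of_covBy hw
  have hcov : ∀ t, m ⋖ t → t = v := fun t ht =>
    D.eq_of_xpos_eq (by rw [grade_eq_add_one_of_covBy ht, hgu, hg])
      (le_antisymm (D.xpos_le_of_covBy (by omega) hmw ht hw) (D.xpos_le_of_covBy hg hum hu ht))
  obtain ⟨t, ht⟩ := exists_covBy_of_wellFoundedLT (not_isMax m)
  have hset : {t : P | m ⋖ t} = {v} := Set.eq_singleton_iff_unique_mem.2 ⟨hcov t ht ▸ ht, hcov⟩
  obtain rfl : 1 = b := by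
    have := hb m
    rw [hset, Set.encard_singleton] at this
    exact_mod_cast this
  exact hum.ne (by rw [hb.grade_injective_of_one hg])

theorem adjacent_of_covBy (D : PlanarDiagram P) (hb : HasUpDegree P b) (hne : v₁ ≠ v₂)
    (h₁ : v₁ ⋖ v) (h₂ : v₂ ⋖ v) : D.Adjacent v₁ v₂ := by
  have hg : grade ℕ v₁ = grade ℕ v₂ := grade_eq_of_covBy_of_covBy h₁ h₂
  exact ⟨hne, hg, fun w hw =>
    ⟨fun h => D.not_covBy_of_xpos_between hb h₁ hw.symm h.1 h.2 h₂,
      fun h => D.not_covBy_of_xpos_between hb h₂ (hg.symm.trans hw.symm) h.1 h.2 h₁⟩⟩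

theorem lowerCovers_eq_pair (D : PlanarDiagram P) (hb : HasUpDegree P b) (hne : v₁ ≠ v₂)
    (h₁ : v₁ ⋖ v) (h₂ : v₂ ⋖ v) : {w : P | w ⋖ v} = {v₁, v₂} := by
  refine Set.Subset.antisymm (fun w hw => ?_) (by rintro w (rfl | rfl) <;> assumption)
  by_contra! hmem
  obtain ⟨hw₁, hw₂⟩ : w ≠ v₁ ∧ w ≠ v₂ := by simpa using hmem
  -- Of three vertices covered by `v`, one would separate the other two.
  obtain ⟨-, hg₂, hbtw⟩ := D.adjacent_of_covBy hb hne h₁ h₂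
  obtain ⟨-, hg₁, hbtw₁⟩ := D.adjacent_of_covBy hb hw₁ hw h₁
  obtain ⟨-, -, hbtw₂⟩ := D.adjacent_of_covBy hb hw₂ hw h₂
  have hx : D.xpos v₁ ≠ D.xpos v₂ := mt (D.eq_of_xpos_eq hg₂) hne
  have hx₁ : D.xpos w ≠ D.xpos v₁ := mt (D.eq_of_xpos_eq hg₁) hw₁
  have hx₂ : D.xpos w ≠ D.xpos v₂ := mt (D.eq_of_xpos_eq (hg₁.trans hg₂)) hw₂
  have := hbtw w hg₁
  have := hbtw₁ v₂ (hg₁.trans hg₂).symm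
  have := hbtw₂ v₁ hg₁.symm
  grind

theorem rootBifurcated_iff (D : PlanarDiagram P) (hb : HasUpDegree P b) :
    D.RootBifurcated v ↔ BifurcatedAt ⊥ v := by
  constructor
  · rintro ⟨v₁, v₂, hne, hset, ⟨z, hz, hglb⟩, -⟩
    obtain rfl : z = ⊥ := hz.eq_bot
    exact ⟨v₁, v₂, hne, hset.superset (.inl rfl), hset.superset (.inr rfl), hglb⟩
  · rintro ⟨v₁, v₂, hne, h₁, h₂, hglb⟩
    exact ⟨v₁, v₂, hne, D.lowerCovers_eq_pair hb hne h₁ h₂, ⟨⊥, isBot_bot, hglb⟩,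
      D.adjacent_of_covBy hb hne h₁ h₂⟩

theorem bifurcatedAt_unique (D : PlanarDiagram P) (hb : HasUpDegree P b) (h : BifurcatedAt c v)
    (h' : BifurcatedAt c' v) : c = c' := by
  obtain ⟨v₁, v₂, hne, h₁, h₂, hglb⟩ := h
  obtain ⟨w₁, w₂, hne', h₁', h₂', hglb'⟩ := h'
  rw [← D.lowerCovers_eq_pair hb hne h₁ h₂] at hglb
  rw [← D.lowerCovers_eq_pair hb hne' h₁' h₂'] at hglb'
  exact hglb.unique hglb'

end UpDegree

theorem bifurcatedAt_map_iff [OrderBot P] (D : PlanarDiagram P) {f : P ↪o P} {c : P}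
    (hf : Set.range f = Set.Ici c) : BifurcatedAt c (f v) ↔ BifurcatedAt ⊥ v := by
  have hglb_iff : ∀ v₁ v₂, v₁ ⋖ v → v₂ ⋖ v → (IsGLB {f v₁, f v₂} c ↔ IsGLB {v₁, v₂} ⊥) := by
    intro v₁ v₂ h₁ h₂
    have hg : grade ℕ (f v₁) = grade ℕ (f v₂) := by
      rw [grade_map_of_range_eq_Ici hf, grade_map_of_range_eq_Ici hf,
        grade_eq_of_covBy_of_covBy h₁ h₂]
    rw [← map_bot_of_range_eq_Ici hf, ← Set.image_pair]
    exact isGLB_image_iff_of_range_eq_Ici hf (Set.image_pair f v₁ v₂ ▸ D.exists_isGLB hg)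
  constructor
  · rintro ⟨t₁, t₂, hne, h₁, h₂, hglb⟩
    obtain ⟨v₁, rfl⟩ := hf.superset (hglb.1 (Set.mem_insert t₁ _))
    obtain ⟨v₂, rfl⟩ := hf.superset (hglb.1 (Set.mem_insert_of_mem _ (Set.mem_singleton t₂)))
    rw [map_covBy_iff_of_range_eq_Ici hf] at h₁ h₂
    exact ⟨v₁, v₂, ne_of_apply_ne f hne, h₁, h₂, (hglb_iff v₁ v₂ h₁ h₂).1 hglb⟩
  · rintro ⟨v₁, v₂, hne, h₁, h₂, hglb⟩
    exact ⟨f v₁, f v₂, f.injective.ne hne, (map_covBy_iff_of_range_eq_Ici hf).2 h₁,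
      (map_covBy_iff_of_range_eq_Ici hf).2 h₂, (hglb_iff v₁ v₂ h₁ h₂).2 hglb⟩

end PlanarDiagram

open Finset.HasAntidiagonal (antidiagonal mem_antidiagonal)

section Recurrence

theorem sum_ncard_comm {α β : Type*} (s : Finset α) (t : Finset β) (r : α → β → Prop) :
    ∑ a ∈ s, {b | b ∈ t ∧ r a b}.ncard = ∑ b ∈ t, {a | a ∈ s ∧ r a b}.ncard := by
  classical
  simpa only [← Set.ncard_coe_finset, Finset.bipartiteAbove, Finset.bipartiteBelow,
    Finset.coe_filter] using
    Finset.sum_card_bipartiteAbove_eq_sum_card_bipartiteBelow r (s := s) (t := t)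

variable {P : Type*} [PartialOrder P] [GradeMinOrder ℕ P] {b : ℕ} {v : P}

/-- The finite set of vertices of rank `k`. -/
noncomputable def IsUpho.rankFinset (h : IsUpho P) (k : ℕ) : Finset P :=
  (h.1 k).toFinset

theorem IsUpho.mem_rankFinset (h : IsUpho P) {k : ℕ} : v ∈ h.rankFinset k ↔ grade ℕ v = k :=
  (h.1 k).mem_toFinset

theorem IsUpho.card_rankFinset (h : IsUpho P) (k : ℕ) :
    (h.rankFinset k).card = {v : P | grade ℕ v = k}.ncard :=
  (Set.ncard_eq_toFinset_card _ (h.1 k)).symm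

theorem IsUpho.sum_ncard_lowerCovers (h : IsUpho P) (hb : HasUpDegree P b) (k : ℕ) :
    ∑ v ∈ h.rankFinset (k + 1), {u : P | u ⋖ v}.ncard = b * {v : P | grade ℕ v = k}.ncard := by
  have hdown : ∀ v ∈ h.rankFinset (k + 1),
      {u : P | u ⋖ v} = {u | u ∈ h.rankFinset k ∧ u ⋖ v} := fun v hv => by
    ext u
    refine ⟨fun hu => ⟨h.mem_rankFinset.2 ?_, hu⟩, And.right⟩
    exact add_right_cancel ((grade_eq_add_one_of_covBy hu).symm.trans (h.mem_rankFinset.1 hv))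
  have hup : ∀ u ∈ h.rankFinset k, {v | v ∈ h.rankFinset (k + 1) ∧ u ⋖ v}.ncard = b :=
    fun u hu => by
      have hset : {v | v ∈ h.rankFinset (k + 1) ∧ u ⋖ v} = {v | u ⋖ v} := by
        ext v
        refine ⟨And.right, fun hv => ⟨h.mem_rankFinset.2 ?_, hv⟩⟩
        rw [grade_eq_add_one_of_covBy hv, h.mem_rankFinset.1 hu]
      rw [hset, Set.ncard, hb u, ENat.toNat_natCast]
  calc ∑ v ∈ h.rankFinset (k + 1), {u : P | u ⋖ v}.ncard
      = ∑ v ∈ h.rankFinset (k + 1), {u | u ∈ h.rankFinset k ∧ u ⋖ v}.ncard :=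
        Finset.sum_congr rfl fun v hv => congrArg Set.ncard (hdown v hv)
    _ = ∑ u ∈ h.rankFinset k, {v | v ∈ h.rankFinset (k + 1) ∧ u ⋖ v}.ncard :=
        (sum_ncard_comm _ _ _).symm
    _ = b * {v : P | grade ℕ v = k}.ncard := by
        rw [Finset.sum_congr rfl hup, Finset.sum_const, smul_eq_mul, h.card_rankFinset, mul_comm]

namespace PlanarDiagram

variable [OrderBot P] [NoMaxOrder P]

theorem ncard_lowerCovers (D : PlanarDiagram P) (hb : HasUpDegree P b) (hv : v ≠ ⊥) :
    {u : P | u ⋖ v}.ncard = 1 + {c : P | BifurcatedAt c v}.ncard := by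
  obtain ⟨u, hu⟩ := exists_covBy_of_ne_bot hv
  by_cases hB : ∃ c, BifurcatedAt c v
  · obtain ⟨c, hc⟩ := hB
    have hcenter : {c | BifurcatedAt c v} = {c} :=
      Set.eq_singleton_iff_unique_mem.2 ⟨hc, fun c' hc' => D.bifurcatedAt_unique hb hc' hc⟩
    obtain ⟨v₁, v₂, hne, h₁, h₂, -⟩ := hc
    rw [hcenter, D.lowerCovers_eq_pair hb hne h₁ h₂, Set.ncard_pair hne, Set.ncard_singleton]
  · have hset : {u : P | u ⋖ v} = {u} := by
      refine Set.eq_singleton_iff_unique_mem.2 ⟨hu, fun w hw => by_contra fun hne => hB ?_⟩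
      obtain ⟨c, hc⟩ := D.exists_isGLB (grade_eq_of_covBy_of_covBy hw hu)
      exact ⟨c, w, u, hne, hw, hu, hc⟩
    have hcenter : {c | BifurcatedAt c v} = ∅ :=
      Set.eq_empty_iff_forall_notMem.2 (not_exists.1 hB)
    rw [hset, hcenter, Set.ncard_singleton, Set.ncard_empty]

theorem ncard_bifurcatedAt (D : PlanarDiagram P) (h : IsUpho P) (hb : HasUpDegree P b) (c : P)
    (i : ℕ) :
    {v : P | grade ℕ v = grade ℕ c + i ∧ BifurcatedAt c v}.ncard = D.rootBifurcatedCount i := by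
  obtain ⟨f, hf⟩ := h.exists_orderEmbedding c
  have hiff : ∀ v, (grade ℕ (f v) = grade ℕ c + i ∧ BifurcatedAt c (f v)) ↔
      (grade ℕ v = i ∧ D.RootBifurcated v) := fun v => by
    rw [grade_map_of_range_eq_Ici hf, add_right_inj, D.bifurcatedAt_map_iff hf,
      D.rootBifurcated_iff hb]
  have himage : {v : P | grade ℕ v = grade ℕ c + i ∧ BifurcatedAt c v} =
      f '' {v : P | grade ℕ v = i ∧ D.RootBifurcated v} := by
    refine Set.Subset.antisymm (fun w hw => ?_) (Set.image_subset_iff.2 fun v => (hiff v).2)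
    obtain ⟨v, rfl⟩ := hf.superset hw.2.le
    exact ⟨v, (hiff v).1 hw, rfl⟩
  rw [himage, Set.ncard_image_of_injective _ f.injective, rootBifurcatedCount]

theorem sum_ncard_bifurcatedAt (D : PlanarDiagram P) (h : IsUpho P) (hb : HasUpDegree P b)
    (k : ℕ) :
    ∑ v ∈ h.rankFinset k, {c : P | BifurcatedAt c v}.ncard =
      ∑ ij ∈ antidiagonal k, D.rootBifurcatedCount ij.1 * {v : P | grade ℕ v = ij.2}.ncard := by
  classical
  let T := (antidiagonal k).biUnion fun ij => h.rankFinset ij.2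
  have hcenters : ∀ v ∈ h.rankFinset k,
      {c | BifurcatedAt c v} = {c | c ∈ T ∧ BifurcatedAt c v} := fun v hv => by
    ext c
    refine ⟨fun hc => ⟨Finset.mem_biUnion.2 ⟨(k - grade ℕ c, grade ℕ c), ?_, ?_⟩, hc⟩, And.right⟩
    · have hle : grade ℕ c ≤ k := h.mem_rankFinset.1 hv ▸ grade_mono hc.le
      exact mem_antidiagonal.2 (Nat.sub_add_cancel hle)
    · exact h.mem_rankFinset.2 rfl
  have hcount : ∀ ij ∈ antidiagonal k, ∀ c ∈ h.rankFinset ij.2,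
      {v | v ∈ h.rankFinset k ∧ BifurcatedAt c v}.ncard = D.rootBifurcatedCount ij.1 := by
    intro ij hij c hc
    rw [← D.ncard_bifurcatedAt h hb c]
    simp only [h.mem_rankFinset, h.mem_rankFinset.1 hc, add_comm ij.2,
      mem_antidiagonal.1 hij]
  have hdisj : (antidiagonal k : Set (ℕ × ℕ)).PairwiseDisjoint
      fun ij => h.rankFinset ij.2 := fun ij hij ij' hij' hne =>
    Finset.disjoint_left.2 fun c hc hc' => hne <|
      (Finset.HasAntidiagonal.antidiagonal_congr' hij hij').2 <|
        (h.mem_rankFinset.1 hc).symm.trans (h.mem_rankFinset.1 hc')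
  rw [Finset.sum_congr rfl fun v hv => congrArg Set.ncard (hcenters v hv), sum_ncard_comm,
    Finset.sum_biUnion hdisj]
  refine Finset.sum_congr rfl fun ij hij => ?_
  rw [Finset.sum_congr rfl (hcount ij hij), Finset.sum_const, smul_eq_mul, h.card_rankFinset,
    mul_comm]

theorem ncard_grade_add_one (D : PlanarDiagram P) (h : IsUpho P) (hb : HasUpDegree P b) (k : ℕ) :
    {v : P | grade ℕ v = k + 1}.ncard + ∑ ij ∈ antidiagonal (k + 1),
      D.rootBifurcatedCount ij.1 * {v : P | grade ℕ v = ij.2}.ncard =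
    b * {v : P | grade ℕ v = k}.ncard := by
  have hlower : ∀ v ∈ h.rankFinset (k + 1),
      {u : P | u ⋖ v}.ncard = 1 + {c : P | BifurcatedAt c v}.ncard := fun v hv =>
    D.ncard_lowerCovers hb <| mt grade_eq_zero_iff.2 <|
      (h.mem_rankFinset.1 hv).trans_ne k.succ_ne_zero
  rw [← h.sum_ncard_lowerCovers hb, Finset.sum_congr rfl hlower, Finset.sum_add_distrib,
    D.sum_ncard_bifurcatedAt h hb, Finset.sum_const, smul_eq_mul, mul_one, h.card_rankFinset]

end PlanarDiagram

end Recurrence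

namespace PlanarDiagram

variable {P : Type*} [PartialOrder P] [GradeMinOrder ℕ P] {D : PlanarDiagram P}
  {v v₁ v₂ y y' m t : P}

theorem RightNeighbor.xpos_le_of_le (h : D.RightNeighbor v₁ v₂) (hg : grade ℕ y = grade ℕ y')
    (hx : D.xpos y ≤ D.xpos y') (hy' : y' ≤ v₂) (hy : ¬ y ≤ v₂) (hyt : y ≤ t)
    (ht : grade ℕ t = grade ℕ v₁) : D.xpos t ≤ D.xpos v₁ :=
  (h.xpos_le_or_le ht).resolve_right fun hlt =>
    hy (D.le_of_crossing hg (ht.trans h.2.2.1) hyt hy' hx hlt).1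

variable [NoMaxOrder P]

theorem RightNeighbor.le_or_le_of_xpos_between (h : D.RightNeighbor v₁ v₂)
    (hg : grade ℕ y = grade ℕ m) (hg' : grade ℕ m = grade ℕ y') (hy : y ≤ v₁) (hy' : y' ≤ v₂)
    (hx : D.xpos y ≤ D.xpos m) (hx' : D.xpos m ≤ D.xpos y') : m ≤ v₁ ∨ m ≤ v₂ := by
  obtain ⟨t, hmt, ht⟩ := exists_ge_grade_eq (u := m) (hg ▸ grade_mono hy)
  refine (h.xpos_le_or_le ht).imp (fun hl => ?_) fun hr => ?_
  · exact (D.le_of_crossing hg ht.symm hy hmt hx hl).2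
  · exact (D.le_of_crossing hg' (ht.trans h.2.2.1) hmt hy' hx' hr).1

theorem RightNeighbor.isLUB_of_covBy (h : D.RightNeighbor v₁ v₂) (h₁ : v₁ ⋖ v) (h₂ : v₂ ⋖ v)
    (hg : grade ℕ y = grade ℕ y') (hy₁ : y ≤ v₁) (hy₂ : ¬ y ≤ v₂) (hy₁' : ¬ y' ≤ v₁)
    (hy₂' : y' ≤ v₂) : IsLUB {y, y'} v := by
  have hgv : grade ℕ v₁ = grade ℕ v₂ := h.2.2.1
  have hx : D.xpos y ≤ D.xpos y' := le_of_not_gt fun hlt =>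
    hy₂ (D.le_of_crossing hg.symm hgv.symm hy₂' hy₁ hlt.le h.1.le).2
  have hleft : ∀ t, y ≤ t → grade ℕ t = grade ℕ v₁ → D.xpos t ≤ D.xpos v₁ := fun t =>
    h.xpos_le_of_le hg hx hy₂' hy₂
  have hright : ∀ t, y' ≤ t → grade ℕ t = grade ℕ v₁ → D.xpos v₂ ≤ D.xpos t := fun t hyt ht =>
    neg_le_neg_iff.1 <|
      h.mirror.xpos_le_of_le hg.symm (neg_le_neg hx) hy₁ hy₁' hyt (ht.trans hgv)
  refine ⟨by simp [upperBounds, hy₁.trans h₁.le, hy₂'.trans h₂.le], fun w hw => ?_⟩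
  have hyw : y ≤ w := hw (Set.mem_insert y _)
  have hyw' : y' ≤ w := hw (Set.mem_insert_of_mem _ rfl)
  rcases le_or_gt (grade ℕ w) (grade ℕ v₁) with hgw | hgw
  · obtain ⟨t, hwt, ht⟩ := exists_ge_grade_eq hgw
    exact absurd ((hright t (hyw'.trans hwt) ht).trans (hleft t (hyw.trans hwt) ht)) h.1.not_ge
  -- Paths from `y` and `y'` to `w` pass `v₁` and `v₂` on the outside, hence enclose `v`.
  obtain ⟨p, hyp, hpw, hp⟩ := exists_grade_eq_of_le hyw (grade_mono hy₁) hgw.le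
  obtain ⟨p', hyp', hpw', hp'⟩ := exists_grade_eq_of_le hyw' (hg ▸ grade_mono hy₁) hgw.le
  obtain ⟨q, hpq, hqw⟩ := exists_covBy_le_of_lt (hpw.lt_of_ne (by rintro rfl; omega))
  obtain ⟨q', hpq', hqw'⟩ := exists_covBy_le_of_lt (hpw'.lt_of_ne (by rintro rfl; omega))
  have hgq := grade_eq_add_one_of_covBy hpq
  have hgq' := grade_eq_add_one_of_covBy hpq'
  have hgv₁ := grade_eq_add_one_of_covBy h₁
  exact D.le_of_xpos_between (by omega) (by omega)
    (D.xpos_le_of_covBy (by omega) ((hleft p hyp hp).trans_lt h.1) hpq h₂)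
    (D.xpos_le_of_covBy (by omega) (h.1.trans_le (hright p' hyp' hp')) h₁ hpq') hqw hqw'

variable [OrderBot P]

theorem RightNeighbor.exists_atoms (h : D.RightNeighbor v₁ v₂) (hfin : {y : P | IsAtom y}.Finite)
    (hdisj : Disjoint v₁ v₂) :
    ∃ y y', IsAtom y ∧ IsAtom y' ∧ y ≤ v₁ ∧ y' ≤ v₂ ∧ D.RightNeighbor y y' := by
  have hg : grade ℕ v₁ = grade ℕ v₂ := h.2.2.1
  have hpos : 1 ≤ grade ℕ v₁ := Nat.one_le_iff_ne_zero.2 fun h₀ => h.2.1 <|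
    (grade_eq_zero_iff.1 h₀).trans (grade_eq_zero_iff.1 (hg ▸ h₀)).symm
  have hatoms : ∀ u : P, 1 ≤ grade ℕ u → {y | IsAtom y ∧ y ≤ u}.Nonempty := fun u hu => by
    obtain ⟨y, -, hyu, hy⟩ :=
      exists_grade_eq_of_le (bot_le (a := u)) (grade_bot.trans_le zero_le_one) hu
    exact ⟨y, isAtom_iff_grade_eq_one.2 hy, hyu⟩
  obtain ⟨y, ⟨hy, hyv⟩, hmax⟩ := Set.exists_max_image {y | IsAtom y ∧ y ≤ v₁} D.xpos
    (hfin.subset fun _ => And.left) (hatoms v₁ hpos)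
  obtain ⟨y', ⟨hy', hyv'⟩, hmin⟩ := Set.exists_min_image {y | IsAtom y ∧ y ≤ v₂} D.xpos
    (hfin.subset fun _ => And.left) (hatoms v₂ (hg ▸ hpos))
  have hgy := isAtom_iff_grade_eq_one.1 hy
  have hgy' := isAtom_iff_grade_eq_one.1 hy'
  refine ⟨y, y', hy, hy', hyv, hyv', rightNeighbor_of_forall (hgy.trans hgy'.symm) ?_ ?_⟩
  · by_contra! hle
    have hyv₂ := (D.le_of_crossing (hgy'.trans hgy.symm) hg.symm hyv' hyv hle h.1.le).2
    exact hy.1 (disjoint_self.1 (hdisj.mono hyv hyv₂))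
  · intro m hm hym
    by_contra! hmy
    have hgm := hm.trans hgy
    have hma := isAtom_iff_grade_eq_one.2 hgm
    rcases h.le_or_le_of_xpos_between hm.symm (hgm.trans hgy'.symm) hyv hyv' hym.le hmy.le with
      hmv | hmv
    · exact (hmax m ⟨hma, hmv⟩).not_gt hym
    · exact (hmin m ⟨hma, hmv⟩).not_gt hmy

variable {b : ℕ}

theorem exists_atoms_isLUB (D : PlanarDiagram P) (hb : HasUpDegree P b)
    (hv : BifurcatedAt ⊥ v) :
    ∃ y y', IsAtom y ∧ IsAtom y' ∧ D.RightNeighbor y y' ∧ IsLUB {y, y'} v := by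
  obtain ⟨v₁, v₂, hne, h₁, h₂, hglb⟩ := hv
  wlog hnext : D.RightNeighbor v₁ v₂ generalizing v₁ v₂
  · have hnext' := (D.adjacent_of_covBy hb hne h₁ h₂).rightNeighbor_or.resolve_left hnext
    exact this v₂ v₁ hne.symm h₂ h₁ (Set.pair_comm v₁ v₂ ▸ hglb) hnext'
  have hdisj : Disjoint v₁ v₂ := fun d hd₁ hd₂ => hglb.2 (by simp [lowerBounds, hd₁, hd₂])
  have hfin : {y : P | IsAtom y}.Finite := by
    simpa only [bot_covBy_iff] using Set.finite_of_encard_eq_coe (hb ⊥)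
  obtain ⟨y, y', hy, hy', hyv, hyv', hyy⟩ := hnext.exists_atoms hfin hdisj
  refine ⟨y, y', hy, hy', hyy, hnext.isLUB_of_covBy h₁ h₂ hyy.2.2.1 hyv ?_ ?_ hyv'⟩
  · exact fun hle => hy.1 (disjoint_self.1 (hdisj.mono hyv hle))
  · exact fun hle => hy'.1 (disjoint_self.1 (hdisj.mono hle hyv'))

theorem finite_rootBifurcated_and_ncard_lt (D : PlanarDiagram P) (hb : HasUpDegree P b) :
    {v : P | D.RootBifurcated v}.Finite ∧ {v : P | D.RootBifurcated v}.ncard < b := by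
  let A : Set P := {y | IsAtom y}
  have hAb : A.encard = b := by simpa only [bot_covBy_iff] using hb ⊥
  have hA : A.Finite := Set.finite_of_encard_eq_coe hAb
  obtain ⟨r₀, hr₀⟩ := exists_covBy_of_wellFoundedLT (not_isMax (⊥ : P))
  obtain ⟨r, hr, hrmax⟩ := Set.exists_max_image A D.xpos hA ⟨r₀, bot_covBy_iff.1 hr₀⟩
  have hatoms : ∀ v, D.RootBifurcated v →
      ∃ y y', y ∈ A ∧ y' ∈ A ∧ D.RightNeighbor y y' ∧ IsLUB {y, y'} v := fun v hv =>
    D.exists_atoms_isLUB hb ((D.rootBifurcated_iff hb).1 hv)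
  choose! y y' hy hy' hyy hlub using hatoms
  have hmaps : Set.MapsTo y {v | D.RootBifurcated v} (A \ {r}) := fun v hv =>
    ⟨hy v hv, fun hvr => (hrmax (y' v) (hy' v hv)).not_gt (hvr ▸ (hyy v hv).1)⟩
  have hinj : Set.InjOn y {v | D.RootBifurcated v} := fun v hv w hw hvw => by
    have hvw' : y' v = y' w := (hyy v hv).right_unique (hvw ▸ hyy w hw)
    have hlubw := hlub w hw
    rw [← hvw, ← hvw'] at hlubw
    exact (hlub v hv).unique hlubw
  have hfin : (A \ {r}).Finite := hA.subset Set.sdiff_subset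
  refine ⟨Set.Finite.of_injOn hmaps hinj hfin, ?_⟩
  calc {v | D.RootBifurcated v}.ncard ≤ (A \ {r}).ncard :=
        Set.ncard_le_ncard_of_injOn y hmaps hinj hfin
    _ < A.ncard := Set.ncard_sdiff_singleton_lt_of_mem hr hA
    _ = b := by rw [Set.ncard, hAb, ENat.toNat_natCast]

end PlanarDiagram

section Denominator

theorem denomPoly_mul_eq_one {b n : ℕ} {a N : ℕ → ℕ} (ha : ∀ i ∉ Finset.Icc 2 n, a i = 0)
    (hN₀ : N 0 = 1)
    (hN : ∀ k, N (k + 1) + ∑ ij ∈ antidiagonal (k + 1), a ij.1 * N ij.2 = b * N k) :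
    (denomPoly b n a : PowerSeries ℤ) * PowerSeries.mk (fun k => (N k : ℤ)) = 1 := by
  have hQ : (denomPoly b n a : PowerSeries ℤ) =
      1 - PowerSeries.C (b : ℤ) * PowerSeries.X + PowerSeries.mk fun i => (a i : ℤ) := by
    have hsum : ((∑ i ∈ Finset.Icc 2 n, C (a i : ℤ) * X ^ i : ℤ[X]) : PowerSeries ℤ) =
        PowerSeries.mk fun i => (a i : ℤ) := by
      ext k
      simp only [Polynomial.coeff_coe, Polynomial.finsetSum_coeff, Polynomial.coeff_C_mul_X_pow,
        Finset.sum_ite_eq, PowerSeries.coeff_mk]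
      split_ifs with hk
      · rfl
      · rw [ha k hk, Nat.cast_zero]
    rw [denomPoly, Polynomial.coe_add, hsum, Polynomial.coe_sub, Polynomial.coe_one,
      Polynomial.coe_mul, Polynomial.coe_C, Polynomial.coe_X]
  ext k
  rw [hQ, add_mul, sub_mul, one_mul, mul_assoc, map_add, map_sub, PowerSeries.coeff_C_mul,
    PowerSeries.coeff_one]
  cases k with
  | zero => simp [hN₀, ha 0]
  | succ k =>
    rw [PowerSeries.coeff_succ_X_mul, PowerSeries.coeff_mul, if_neg k.succ_ne_zero]
    simp only [PowerSeries.coeff_mk]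
    have := hN k
    zify at this
    linarith

theorem eval_one_denomPoly (b n : ℕ) (a : ℕ → ℕ) :
    (denomPoly b n a).eval 1 = 1 - (b : ℤ) + (∑ i ∈ Finset.Icc 2 n, a i : ℕ) := by
  simp [denomPoly, Polynomial.eval_finsetSum]

variable {P : Type*} [PartialOrder P] [GradeMinOrder ℕ P]

namespace PlanarDiagram

theorem sum_rootBifurcatedCount_le (D : PlanarDiagram P)
    (hfin : {v : P | D.RootBifurcated v}.Finite) (s : Finset ℕ) :
    ∑ i ∈ s, D.rootBifurcatedCount i ≤ {v : P | D.RootBifurcated v}.ncard := by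
  classical
  have hcount : ∀ i, D.rootBifurcatedCount i = {v ∈ hfin.toFinset | grade ℕ v = i}.card :=
    fun i => by
      rw [rootBifurcatedCount, ← Set.ncard_coe_finset]
      simp [and_comm]
  simp only [hcount, Set.ncard_eq_toFinset_card _ hfin]
  rw [Finset.sum_card_fiberwise_eq_card_filter]
  exact Finset.card_filter_le _ _

theorem rootBifurcatedCount_eq_zero (D : PlanarDiagram P) {i : ℕ}
    (hi : ∀ v, D.RootBifurcated v → grade ℕ v ≠ i) : D.rootBifurcatedCount i = 0 := by
  have hempty : {v : P | grade ℕ v = i ∧ D.RootBifurcated v} = ∅ :=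
    Set.eq_empty_iff_forall_notMem.2 fun v hv => hi v hv.2 hv.1
  rw [rootBifurcatedCount, hempty, Set.ncard_empty]

theorem RootBifurcated.two_le_grade [OrderBot P] {D : PlanarDiagram P} {v : P}
    (hv : D.RootBifurcated v) : 2 ≤ grade ℕ v := by
  obtain ⟨v₁, v₂, hne, hset, -, -, hg, -⟩ := hv
  have hgv := grade_eq_add_one_of_covBy (hset.superset (.inl rfl) : v₁ ⋖ v)
  have hpos : grade ℕ v₁ ≠ 0 := fun h₀ => hne <|
    (grade_eq_zero_iff.1 h₀).trans (grade_eq_zero_iff.1 (hg ▸ h₀)).symm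
  omega

end PlanarDiagram

theorem IsUpho.exists_denomPoly_mul_rankGenFun [Infinite P] (h : IsUpho P) (D : PlanarDiagram P) :
    ∃ b n : ℕ, HasUpDegree P b ∧
      (∀ i : ℕ, i ∉ Finset.Icc 2 n → D.rootBifurcatedCount i = 0) ∧
      (denomPoly b n D.rootBifurcatedCount : PowerSeries ℤ) * rankGenFun P = 1 ∧
      (denomPoly b n D.rootBifurcatedCount).eval 1 ≤ 0 := by
  obtain ⟨z, hz⟩ := h.exists_isBot
  let : OrderBot P := { bot := z, bot_le := hz }
  have : NoMaxOrder P := h.noMaxOrder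
  have hb := h.hasUpDegree
  obtain ⟨hfin, hlt⟩ := D.finite_rootBifurcated_and_ncard_lt hb
  obtain ⟨n, hn⟩ := (hfin.image (grade ℕ)).bddAbove
  have hsupp : ∀ i ∉ Finset.Icc 2 n, D.rootBifurcatedCount i = 0 := fun i hi =>
    D.rootBifurcatedCount_eq_zero fun v hv hvi =>
      hi (Finset.mem_Icc.2 (hvi ▸ ⟨hv.two_le_grade, hn ⟨v, hv, rfl⟩⟩))
  refine ⟨_, n, hb, hsupp, denomPoly_mul_eq_one hsupp ?_ (D.ncard_grade_add_one h hb), ?_⟩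
  · simp only [grade_eq_zero_iff, Set.ofPred_eq_eq_singleton, Set.ncard_singleton]
  · have := D.sum_rootBifurcatedCount_le hfin (Finset.Icc 2 n)
    rw [eval_one_denomPoly]
    omega

end Denominator

/-- The index at which the children of the `i`-th vertex of a row start in the next row, when every
vertex has `c + 1` children and the last child of `j` is the first of `j + 1` iff `g j = 1`. -/
def blockStart (c : ℕ) (g : ℕ → ℕ) (i : ℕ) : ℕ :=
  ∑ j ∈ Finset.range i, (c + if g j = 1 then 0 else 1)

theorem blockStart_succ (c : ℕ) (g : ℕ → ℕ) (i : ℕ) :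
    blockStart c g (i + 1) = blockStart c g i + c + if g i = 1 then 0 else 1 := by
  rw [blockStart, Finset.sum_range_succ, ← blockStart, add_assoc]

theorem blockStart_monotone (c : ℕ) (g : ℕ → ℕ) : Monotone (blockStart c g) :=
  monotone_nat_of_le_succ fun i => by rw [blockStart_succ]; omega

theorem le_blockStart {c : ℕ} (hc : 0 < c) (g : ℕ → ℕ) (i : ℕ) : i ≤ blockStart c g i := by
  induction i with
  | zero => exact Nat.zero_le _
  | succ i ih => rw [blockStart_succ]; omega

theorem blockStart_congr {c : ℕ} {g g' : ℕ → ℕ} {i : ℕ} (h : ∀ j < i, g j = g' j) :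
    blockStart c g i = blockStart c g' i :=
  Finset.sum_congr rfl fun j hj => by rw [h j (Finset.mem_range.1 hj)]

theorem blockStart_add (c : ℕ) (g : ℕ → ℕ) (s t : ℕ) :
    blockStart c g (s + t) = blockStart c g s + blockStart c (fun j => g (s + j)) t :=
  Finset.sum_range_add _ s t

/-- The combinatorial data of a planar upho poset of up-degree `c + 1`, each of whose rows is an
initial segment of one infinite row. The gap between the vertices `i` and `i + 1` is the number of
rows after which the last descendant of `i` meets the first descendant of `i + 1`, with `0` standing
for never. The gaps between the children of a single vertex are `d 0, …, d (c - 1)`, and the gap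
between the children of two consecutive vertices is one less than the gap between these; by
truncated subtraction it is again `0` if they never meet. -/
structure GapWord (c : ℕ) (d : ℕ → ℕ) where
  /-- the gap between the vertices of index `i` and `i + 1` -/
  gap : ℕ → ℕ
  gap_inner : ∀ i t, t < c → gap (blockStart c gap i + t) = d t
  gap_outer : ∀ i, gap i ≠ 1 → gap (blockStart c gap i + c) = gap i - 1

/-- The gap word constructed by recursion: the `m`-th gap lies in the block of children of the last
vertex `i` whose block starts at or before `m`, and `i < m`. -/
def gapSeq (c : ℕ) (d : ℕ → ℕ) (m : ℕ) : ℕ :=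
  let g : ℕ → ℕ := fun j => if _ : j < m then gapSeq c d j else 0
  let i := Nat.findGreatest (fun i => blockStart c g i ≤ m) m
  if m - blockStart c g i < c then d (m - blockStart c g i) else g i - 1
termination_by m

theorem gapSeq_eq {c : ℕ} {d : ℕ → ℕ} {m i : ℕ} (him : i ≤ m)
    (h₁ : blockStart c (gapSeq c d) i ≤ m) (h₂ : m < blockStart c (gapSeq c d) (i + 1)) :
    gapSeq c d m = if m - blockStart c (gapSeq c d) i < c then
      d (m - blockStart c (gapSeq c d) i) else (if i < m then gapSeq c d i else 0) - 1 := by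
  have hstart : ∀ k ≤ m, blockStart c (fun j => if j < m then gapSeq c d j else 0) k =
      blockStart c (gapSeq c d) k := fun k hk =>
    blockStart_congr fun j hj => if_pos (hj.trans_le hk)
  have hgreatest : Nat.findGreatest
      (fun i => blockStart c (fun j => if j < m then gapSeq c d j else 0) i ≤ m) m = i := by
    refine Nat.findGreatest_eq_iff.2
      ⟨him, fun _ => (hstart i him).trans_le h₁, fun k hik hkm => ?_⟩
    rw [hstart k hkm, not_le]
    exact h₂.trans_le (blockStart_monotone c _ hik)
  rw [gapSeq]
  simp only [dite_eq_ite]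
  rw [hgreatest, hstart i him]

theorem GapWord.nonempty (c : ℕ) (d : ℕ → ℕ) : Nonempty (GapWord c d) := by
  rcases Nat.eq_zero_or_pos c with rfl | hc
  · exact ⟨⟨fun _ => 0, fun _ _ h => absurd h (Nat.not_lt_zero _), fun _ _ => rfl⟩⟩
  refine ⟨⟨gapSeq c d, fun i t ht => ?_, fun i hi => ?_⟩⟩
  · have := le_blockStart hc (gapSeq c d) i
    rw [gapSeq_eq (i := i) (by omega) (by omega) (by rw [blockStart_succ]; omega),
      Nat.add_sub_cancel_left, if_pos ht]
  · have := le_blockStart hc (gapSeq c d) i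
    rw [gapSeq_eq (i := i) (by omega) (by omega) (by rw [blockStart_succ, if_neg hi]; omega),
      Nat.add_sub_cancel_left, if_neg (lt_irrefl c), if_pos (by omega)]

namespace GapWord

variable {c : ℕ} {d : ℕ → ℕ} (S : GapWord c d)

/-- The index of the first child of the vertex `i`. -/
def fst (i : ℕ) : ℕ := blockStart c S.gap i

/-- The index of the last child of the vertex `i`. -/
def lst (i : ℕ) : ℕ := S.fst i + c

/-- The index of the last vertex of row `k`, the rows being the iterated children of the vertex `0`;
row `k` has `S.width k + 1` vertices. -/
def width (k : ℕ) : ℕ := S.lst^[k] 0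

theorem fst_zero : S.fst 0 = 0 := rfl

theorem fst_succ (i : ℕ) : S.fst (i + 1) = S.fst i + c + if S.gap i = 1 then 0 else 1 :=
  blockStart_succ c S.gap i

theorem fst_monotone : Monotone S.fst := blockStart_monotone c S.gap

theorem lst_monotone : Monotone S.lst := fun _ _ h => Nat.add_le_add_right (S.fst_monotone h) c

theorem lst_le_fst_of_lt {i j : ℕ} (h : i < j) : S.lst i ≤ S.fst j := by
  calc S.lst i ≤ S.fst (i + 1) := by rw [fst_succ, lst]; omega
    _ ≤ S.fst j := S.fst_monotone h

theorem width_succ (k : ℕ) : S.width (k + 1) = S.lst (S.width k) :=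
  Function.iterate_succ_apply' S.lst k 0

theorem iterate_lst_le_width {i k : ℕ} (hi : i ≤ S.width k) (m : ℕ) :
    S.lst^[m] i ≤ S.width (k + m) := by
  rw [add_comm, width, Function.iterate_add_apply]
  exact S.lst_monotone.iterate m hi

theorem iterate_fst_le_iterate_lst (m i : ℕ) : S.fst^[m] i ≤ S.lst^[m] i :=
  S.fst_monotone.iterate_le_of_le (fun _ => Nat.le_add_right _ _) m i

theorem exists_parent {i j t : ℕ} (hij : i ≤ j) (h₁ : S.fst i ≤ t) (h₂ : t ≤ S.lst j) :
    ∃ s, i ≤ s ∧ s ≤ j ∧ S.fst s ≤ t ∧ t ≤ S.lst s := by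
  induction j, hij using Nat.le_induction with
  | base => exact ⟨i, le_rfl, le_rfl, h₁, h₂⟩
  | succ j hij ih =>
    rcases le_or_gt (S.fst (j + 1)) t with h | h
    · exact ⟨j + 1, by omega, le_rfl, h, h₂⟩
    · have hj : t ≤ S.lst j := by rw [fst_succ] at h; rw [lst]; split_ifs at h <;> omega
      obtain ⟨s, his, hsj, hs⟩ := ih hj
      exact ⟨s, his, by omega, hs⟩

theorem exists_block {n t : ℕ} (h : t < S.lst n) :
    (∃ s ≤ n, ∃ r < c, t = S.fst s + r) ∨ ∃ s < n, S.gap s ≠ 1 ∧ t = S.fst s + c := by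
  obtain ⟨s, hsn, hs, hlast⟩ : ∃ s ≤ n, S.fst s ≤ t ∧ (s < n → t < S.fst (s + 1)) :=
    ⟨Nat.findGreatest (S.fst · ≤ t) n, Nat.findGreatest_le n,
      Nat.findGreatest_spec (P := (S.fst · ≤ t)) n.zero_le (S.fst_zero.trans_le t.zero_le),
      fun hs => not_le.1 <|
        Nat.findGreatest_is_greatest (P := (S.fst · ≤ t)) (Nat.lt_succ_self _) hs⟩
  obtain ⟨r, rfl⟩ := Nat.exists_eq_add_of_le hs
  rcases lt_or_ge r c with hr | hr
  · exact .inl ⟨s, hsn, r, hr, rfl⟩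
  have hsn : s < n := hsn.lt_of_ne (by rintro rfl; rw [lst] at h; omega)
  have hlt := hlast hsn
  rw [fst_succ] at hlt
  split_ifs at hlt with hgap
  · omega
  · exact .inr ⟨s, hsn, hgap, by omega⟩

section SelfSimilarity

variable {A n t m i k : ℕ}

theorem fst_add (hA : ∀ t < n, S.gap (A + t) = S.gap t) (ht : t ≤ n) :
    S.fst (A + t) = S.fst A + S.fst t := by
  rw [fst, blockStart_add, blockStart_congr fun j hj => hA j (hj.trans_le ht), fst, fst]

theorem gap_fst_add (hA : ∀ t < n, S.gap (A + t) = S.gap t) (ht : t < S.lst n) :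
    S.gap (S.fst A + t) = S.gap t := by
  rcases S.exists_block ht with ⟨s, hs, r, hr, rfl⟩ | ⟨s, hs, hgap, rfl⟩
  · rw [← add_assoc, ← S.fst_add hA hs, fst, fst, S.gap_inner _ _ hr, S.gap_inner _ _ hr]
  · rw [← add_assoc, ← S.fst_add hA hs.le, fst, fst, S.gap_outer s hgap,
      S.gap_outer _ (hA s hs ▸ hgap), hA s hs]

theorem gap_iterate_fst_add (m i : ℕ) : ∀ t < S.width m, S.gap (S.fst^[m] i + t) = S.gap t := by
  induction m with
  | zero => exact fun t ht => absurd ht t.not_lt_zero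
  | succ m ih =>
    rw [Function.iterate_succ_apply', width_succ]
    exact fun t => S.gap_fst_add ih

theorem iterate_lst_eq (m i : ℕ) : S.lst^[m] i = S.fst^[m] i + S.width m := by
  induction m with
  | zero => rfl
  | succ m ih =>
    rw [Function.iterate_succ_apply', Function.iterate_succ_apply', width_succ, ih, lst, lst,
      S.fst_add (S.gap_iterate_fst_add m i) le_rfl, add_assoc]

theorem iterate_fst_add (ht : t ≤ S.width k) (m : ℕ) :
    S.fst^[m] (S.fst^[k] i + t) = S.fst^[k + m] i + S.fst^[m] t := by
  induction m with
  | zero => rfl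
  | succ m ih =>
    rw [← add_assoc]
    simp only [Function.iterate_succ_apply', ih]
    exact S.fst_add (S.gap_iterate_fst_add (k + m) i)
      ((S.iterate_fst_le_iterate_lst m t).trans (S.iterate_lst_le_width ht m))

theorem iterate_lst_add (ht : t ≤ S.width k) (m : ℕ) :
    S.lst^[m] (S.fst^[k] i + t) = S.fst^[k + m] i + S.lst^[m] t := by
  rw [iterate_lst_eq, S.iterate_fst_add ht, iterate_lst_eq, add_assoc]

end SelfSimilarity

section Counting

variable {r : ℕ}

theorem fst_add_count_gap (n : ℕ) : S.fst n + Nat.count (S.gap · = 1) n = (c + 1) * n := by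
  induction n with
  | zero => rfl
  | succ n ih =>
    rw [fst_succ, Nat.count_succ, mul_add, ← ih]
    split_ifs <;> ring

theorem count_gap_lst_eq_count_gap_fst (n : ℕ) :
    Nat.count (S.gap · = r) (S.lst n) =
      Nat.count (S.gap · = r) (S.fst n) + Nat.count (d · = r) c := by
  rw [lst, Nat.count_add, Nat.add_left_cancel_iff]
  rw [Nat.count_eq_card_filter_range, Nat.count_eq_card_filter_range]
  refine congrArg Finset.card (Finset.filter_congr fun t ht => ?_)
  rw [fst, S.gap_inner n t (Finset.mem_range.1 ht)]

theorem count_gap_fst_succ (hr : r ≠ 0) (n : ℕ) :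
    Nat.count (S.gap · = r) (S.fst (n + 1)) =
      Nat.count (S.gap · = r) (S.lst n) + if S.gap n = r + 1 then 1 else 0 := by
  rw [fst_succ, ← lst]
  by_cases hgap : S.gap n = 1
  · rw [if_pos hgap, if_neg (by omega), add_zero, add_zero]
  · rw [if_neg hgap, Nat.count_succ, lst, fst, S.gap_outer n hgap]
    exact congrArg _ (if_congr (by omega) rfl rfl)

theorem count_gap_lst (hr : r ≠ 0) (n : ℕ) :
    Nat.count (S.gap · = r) (S.lst n) =
      Nat.count (d · = r) c * (n + 1) + Nat.count (S.gap · = r + 1) n := by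
  induction n with
  | zero =>
    rw [count_gap_lst_eq_count_gap_fst, fst_zero, Nat.count_zero, Nat.count_zero]
    ring
  | succ n ih =>
    rw [count_gap_lst_eq_count_gap_fst, S.count_gap_fst_succ hr, ih, Nat.count_succ]
    ring

theorem count_gap_width (hr : r ≠ 0) (k : ℕ) :
    Nat.count (S.gap · = r) (S.width (k + 1)) =
      ∑ ij ∈ antidiagonal k, Nat.count (d · = r + ij.1) c * (S.width ij.2 + 1) := by
  induction k generalizing r with
  | zero =>
    rw [width_succ, S.count_gap_lst hr]
    simp [width]
  | succ k ih =>
    rw [width_succ, S.count_gap_lst hr, ih r.succ_ne_zero, Finset.Nat.sum_antidiagonal_succ]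
    simp only [add_zero, Nat.succ_eq_add_one, add_assoc, add_comm 1]

theorem width_add_sum_antidiagonal {a : ℕ → ℕ} (ha₀ : a 0 = 0) (ha₁ : a 1 = 0)
    (had : ∀ r ≠ 0, Nat.count (d · = r) c = a (r + 1)) (k : ℕ) :
    S.width (k + 1) + 1 + ∑ ij ∈ antidiagonal (k + 1), a ij.1 * (S.width ij.2 + 1) =
      (c + 1) * (S.width k + 1) := by
  have hcount : ∑ ij ∈ antidiagonal (k + 1), a ij.1 * (S.width ij.2 + 1) =
      Nat.count (S.gap · = 1) (S.width k) := by
    cases k with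
    | zero => simp [Finset.Nat.sum_antidiagonal_succ, ha₀, ha₁, width]
    | succ k =>
      rw [S.count_gap_width one_ne_zero, Finset.Nat.sum_antidiagonal_succ,
        Finset.Nat.sum_antidiagonal_succ, ha₀, ha₁, zero_mul, zero_mul, zero_add, zero_add]
      refine Finset.sum_congr rfl fun ij _ => ?_
      rw [had _ (by omega), add_comm 1]
  rw [hcount, width_succ, lst, mul_add, ← S.fst_add_count_gap]
  ring

end Counting

/-- A vertex of the planar upho poset determined by `S`, given by its rank and its index among the
vertices of that rank. -/
@[ext]
structure Vertex where
  /-- the rank -/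
  rank : ℕ
  /-- the index in the row -/
  idx : ℕ
  idx_le : idx ≤ S.width rank

namespace Vertex

variable {S} {v w : S.Vertex}

instance : PartialOrder S.Vertex where
  le v w := ∃ m, w.rank = v.rank + m ∧ S.fst^[m] v.idx ≤ w.idx ∧ w.idx ≤ S.lst^[m] v.idx
  le_refl v := ⟨0, rfl, le_rfl, le_rfl⟩
  le_trans := by
    rintro u v w ⟨m, hm, hfm, hlm⟩ ⟨l, hl, hfl, hll⟩
    refine ⟨l + m, by omega, ?_, ?_⟩ <;> rw [Function.iterate_add_apply]
    · exact (S.fst_monotone.iterate l hfm).trans hfl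
    · exact hll.trans (S.lst_monotone.iterate l hlm)
  le_antisymm := by
    rintro u v ⟨m, hm, hfm, hlm⟩ ⟨l, hl, -, -⟩
    obtain rfl : m = 0 := by omega
    exact Vertex.ext hm.symm (le_antisymm hfm hlm)

theorem le_iff :
    v ≤ w ↔ ∃ m, w.rank = v.rank + m ∧ S.fst^[m] v.idx ≤ w.idx ∧ w.idx ≤ S.lst^[m] v.idx := Iff.rfl

theorem rank_strictMono : StrictMono (rank : S.Vertex → ℕ) := by
  intro v w h
  obtain ⟨m, hm, hfm, hlm⟩ := h.le
  refine lt_of_le_of_ne (by omega) fun hr => h.ne ?_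
  obtain rfl : m = 0 := by omega
  exact Vertex.ext hr (le_antisymm hfm hlm)

theorem exists_between {m : ℕ} (h : v ≤ w) (hm : w.rank = v.rank + m + 1) :
    ∃ u : S.Vertex, u.rank = v.rank + m ∧ v ≤ u ∧ u ≤ w := by
  obtain ⟨l, hl, hf, hlst⟩ := h
  obtain rfl : l = m + 1 := by omega
  rw [Function.iterate_succ_apply'] at hf hlst
  obtain ⟨s, hs, hs', hfs, hls⟩ := S.exists_parent (S.iterate_fst_le_iterate_lst m v.idx) hf hlst
  exact ⟨⟨v.rank + m, s, hs'.trans (S.iterate_lst_le_width v.idx_le m)⟩, rfl, ⟨m, rfl, hs, hs'⟩,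
    ⟨1, hm, hfs, hls⟩⟩

theorem covBy_iff :
    v ⋖ w ↔ w.rank = v.rank + 1 ∧ S.fst v.idx ≤ w.idx ∧ w.idx ≤ S.lst v.idx := by
  constructor
  · intro h
    obtain ⟨m, hm, hf, hl⟩ := h.le
    cases m with
    | zero => exact absurd hm (rank_strictMono h.lt).ne'
    | succ m =>
      obtain ⟨u, hu, hvu, huw⟩ := exists_between h.le hm
      have hwu : w ≠ u := by rintro rfl; omega
      obtain rfl : v = u := ((h.eq_or_eq hvu huw).resolve_right hwu.symm).symm
      obtain rfl : m = 0 := by omega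
      exact ⟨hm, hf, hl⟩
  · rintro ⟨hr, hf, hl⟩
    refine ⟨lt_of_le_of_ne ⟨1, hr, hf, hl⟩ (by rintro rfl; omega), fun u hvu huw => ?_⟩
    have := rank_strictMono hvu
    have := rank_strictMono huw
    omega

instance : OrderBot S.Vertex where
  bot := ⟨0, 0, Nat.zero_le _⟩
  bot_le v := ⟨v.rank, (zero_add _).symm,
    (Function.iterate_fixed S.fst_zero v.rank).trans_le (Nat.zero_le _), v.idx_le⟩

instance : GradeMinOrder ℕ S.Vertex where
  grade := rank
  grade_strictMono := rank_strictMono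
  covBy_grade _ _ h := Nat.covBy_iff_add_one_eq.2 (covBy_iff.1 h).1.symm
  isMin_grade v h := by
    obtain rfl : v = ⊥ := h.eq_bot
    exact isMin_bot

instance : Infinite S.Vertex :=
  Infinite.of_injective (fun k : ℕ => (⟨k, 0, Nat.zero_le _⟩ : S.Vertex))
    fun _ _ h => congrArg rank h

theorem injOn_idx (k : ℕ) : Set.InjOn (idx : S.Vertex → ℕ) {v | grade ℕ v = k} :=
  fun _ hv _ hw h => Vertex.ext (Eq.trans hv (Eq.symm hw)) h

theorem image_idx_grade (k : ℕ) :
    idx '' {v : S.Vertex | grade ℕ v = k} = Finset.Iic (S.width k) := by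
  ext i
  simp only [Set.mem_image, Set.mem_ofPred_eq, Finset.coe_Iic, Set.mem_Iic]
  constructor
  · rintro ⟨v, rfl, rfl⟩
    exact v.idx_le
  · exact fun hi => ⟨⟨k, i, hi⟩, rfl, rfl⟩

theorem finite_grade (k : ℕ) : {v : S.Vertex | grade ℕ v = k}.Finite :=
  Set.Finite.of_finite_image (image_idx_grade k ▸ Finset.finite_toSet _) (injOn_idx k)

theorem ncard_grade (k : ℕ) : {v : S.Vertex | grade ℕ v = k}.ncard = S.width k + 1 := by
  rw [← (injOn_idx k).ncard_image, image_idx_grade, Set.ncard_coe_finset, Nat.card_Iic]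

/-- The embedding of the poset onto the principal filter of `s`. -/
def shift (s : S.Vertex) : S.Vertex ↪o S.Vertex :=
  OrderEmbedding.ofMapLEIff
    (fun v => ⟨s.rank + v.rank, S.fst^[v.rank] s.idx + v.idx, by
      refine le_trans ?_ (S.iterate_lst_le_width s.idx_le v.rank)
      rw [iterate_lst_eq]
      exact Nat.add_le_add_left v.idx_le _⟩)
    fun v w => by
      simp only [le_iff]
      refine exists_congr fun m => ?_
      rw [S.iterate_fst_add v.idx_le, S.iterate_lst_add v.idx_le, add_assoc,
        Nat.add_left_cancel_iff]
      refine and_congr_right fun hm => ?_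
      rw [hm, Nat.add_le_add_iff_left, Nat.add_le_add_iff_left]

theorem range_shift (s : S.Vertex) : Set.range s.shift = Set.Ici s := by
  ext w
  constructor
  · rintro ⟨v, rfl⟩
    refine ⟨v.rank, rfl, Nat.le_add_right _ _, ?_⟩
    rw [iterate_lst_eq]
    exact Nat.add_le_add_left v.idx_le _
  · rintro ⟨m, hm, hf, hl⟩
    rw [iterate_lst_eq] at hl
    exact ⟨⟨m, w.idx - S.fst^[m] s.idx, by omega⟩, Vertex.ext hm.symm (Nat.add_sub_cancel' hf)⟩

theorem isUpho : IsUpho S.Vertex :=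
  ⟨finite_grade, fun s =>
    ⟨(OrderIso.setCongr _ _ s.range_shift.symm).trans s.shift.orderIso.symm⟩⟩

theorem hasUpDegree : HasUpDegree S.Vertex (c + 1) := by
  intro v
  have hinj : Set.InjOn idx {w | v ⋖ w} :=
    (injOn_idx (v.rank + 1)).mono fun w hw => (covBy_iff.1 hw).1
  have himage : idx '' {w | v ⋖ w} = Finset.Icc (S.fst v.idx) (S.lst v.idx) := by
    ext j
    simp only [Set.mem_image, Set.mem_ofPred_eq, Finset.coe_Icc, Set.mem_Icc, covBy_iff]
    constructor
    · rintro ⟨w, hw, rfl⟩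
      exact hw.2
    · exact fun hj =>
        ⟨⟨v.rank + 1, j, hj.2.trans (S.iterate_lst_le_width v.idx_le 1)⟩, ⟨rfl, hj⟩, rfl⟩
  rw [← hinj.encard_image, himage, Set.encard_coe_eq_coe_finsetCard, Nat.card_Icc, lst, add_assoc,
    Nat.add_sub_cancel_left]

/-- The diagram drawing the `i`-th vertex of rank `k` at the point `(i, k)`. -/
def planarDiagram (S : GapWord c d) : PlanarDiagram S.Vertex :=
  .ofMonotone (fun v => v.idx) (fun _ _ hr hx => Vertex.ext hr (Nat.cast_injective hx))
    fun u v u' v' _ hx h h' => by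
      have hlt : u.idx < u'.idx := Nat.cast_lt.1 hx
      have hle : v.idx ≤ v'.idx :=
        (covBy_iff.1 h).2.2.trans ((S.lst_le_fst_of_lt hlt).trans (covBy_iff.1 h').2.1)
      exact Nat.cast_le.2 hle

end Vertex

end GapWord

theorem exists_count_eq {α : Type*} [DecidableEq α] (e : α) (M : Multiset α) {c : ℕ}
    (hc : M.card ≤ c) : ∃ d : ℕ → α, ∀ r ≠ e, Nat.count (d · = r) c = M.count r := by
  induction M using Multiset.induction_on generalizing c with
  | empty =>
    exact ⟨fun _ => e, fun r hr => Nat.count_of_forall_not fun _ _ => hr.symm⟩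
  | cons x M ih =>
    rw [Multiset.card_cons] at hc
    obtain ⟨c, rfl⟩ := Nat.exists_eq_add_of_le' (Nat.one_le_of_lt hc)
    obtain ⟨d, hd⟩ := ih (Nat.le_of_succ_le_succ hc)
    refine ⟨fun t => Nat.casesOn t x d, fun r hr => ?_⟩
    rw [Nat.count_succ', Multiset.count_cons]
    exact congrArg₂ _ (hd r hr) (if_congr eq_comm rfl rfl)

theorem denomPoly_congr {b n : ℕ} {a a' : ℕ → ℕ} (h : ∀ i ∈ Finset.Icc 2 n, a i = a' i) :
    denomPoly b n a = denomPoly b n a' := by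
  rw [denomPoly, denomPoly, Finset.sum_congr rfl fun i hi => by rw [h i hi]]

theorem exists_planar_upho_of_support {c n : ℕ} {a : ℕ → ℕ}
    (ha : ∀ i ∉ Finset.Icc 2 n, a i = 0) (hc : ∑ i ∈ Finset.Icc 2 n, a i ≤ c) :
    ∃ (P : Type) (_ : PartialOrder P) (_ : GradeMinOrder ℕ P),
      Infinite P ∧ IsUpho P ∧ Nonempty (PlanarDiagram P) ∧ HasUpDegree P (c + 1) ∧
      (denomPoly (c + 1) n a : PowerSeries ℤ) * rankGenFun P = 1 := by
  obtain ⟨d, hd⟩ := exists_count_eq 0 (∑ i ∈ Finset.Icc 2 n, Multiset.replicate (a i) (i - 1))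
    (c := c) (by simpa using hc)
  have had : ∀ r ≠ 0, Nat.count (d · = r) c = a (r + 1) := fun r hr => by
    rw [hd r hr, Multiset.count_sum', Finset.sum_eq_single (r + 1)]
    · simp
    · intro i hi hne
      have := Finset.mem_Icc.1 hi
      exact Multiset.count_eq_zero.2 fun hmem => by
        have := Multiset.eq_of_mem_replicate hmem
        omega
    · intro hmem
      rw [ha _ hmem, Multiset.replicate_zero, Multiset.count_zero]
  obtain ⟨S⟩ := GapWord.nonempty c d
  refine ⟨S.Vertex, inferInstance, inferInstance, inferInstance, GapWord.Vertex.isUpho,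
    ⟨GapWord.Vertex.planarDiagram S⟩, GapWord.Vertex.hasUpDegree, ?_⟩
  simp only [rankGenFun, GapWord.Vertex.ncard_grade]
  exact denomPoly_mul_eq_one ha rfl
    (S.width_add_sum_antidiagonal (ha 0 (by simp)) (ha 1 (by simp)) had)

theorem exists_planar_upho (b n : ℕ) (a : ℕ → ℕ) (h : (denomPoly b n a).eval 1 ≤ 0) :
    ∃ (P : Type) (_ : PartialOrder P) (_ : GradeMinOrder ℕ P),
      Infinite P ∧ IsUpho P ∧ Nonempty (PlanarDiagram P) ∧ HasUpDegree P b ∧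
      (denomPoly b n a : PowerSeries ℤ) * rankGenFun P = 1 := by
  rw [eval_one_denomPoly] at h
  obtain ⟨c, rfl⟩ : ∃ c, b = c + 1 := ⟨b - 1, by omega⟩
  let a' : ℕ → ℕ := fun i => if i ∈ Finset.Icc 2 n then a i else 0
  have haa' : ∀ i ∈ Finset.Icc 2 n, a i = a' i := fun i hi => (if_pos hi).symm
  rw [denomPoly_congr haa']
  refine exists_planar_upho_of_support (fun i hi => if_neg hi) ?_
  have hsum : ∑ i ∈ Finset.Icc 2 n, a i ≤ c := by omega
  exact (Finset.sum_congr rfl haa').symm.trans_le hsum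

theorem theorem1p3 :
    (∀ (P : Type*) [PartialOrder P] [GradeMinOrder ℕ P] [Infinite P], IsUpho P →
      ∀ D : PlanarDiagram P, ∃ b n : ℕ,
        HasUpDegree P b ∧
        (∀ i : ℕ, i ∉ Finset.Icc 2 n → D.rootBifurcatedCount i = 0) ∧
        (denomPoly b n D.rootBifurcatedCount : PowerSeries ℤ) * rankGenFun P = 1 ∧
        (denomPoly b n D.rootBifurcatedCount).eval 1 ≤ 0) ∧
    (∀ (b n : ℕ) (a : ℕ → ℕ), (denomPoly b n a).eval 1 ≤ 0 →
      ∃ (P : Type) (_ : PartialOrder P) (_ : GradeMinOrder ℕ P),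
        Infinite P ∧ IsUpho P ∧ Nonempty (PlanarDiagram P) ∧ HasUpDegree P b ∧
        (denomPoly b n a : PowerSeries ℤ) * rankGenFun P = 1) := by
  exact ⟨fun P _ _ _ h D => h.exists_denomPoly_mul_rankGenFun D, exists_planar_upho⟩
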